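/- Let $k$ be a field of prime characteristic $p$ that is $F$-finite, i.e. the Frobenius map $k\to k$, $a\mapsto a^p$, makes $k$ a finite module over itself. Let $\ell\ge 1$ be an integer and let $R\subseteq k[x,y]$ be the $\ell$-th Veronese subring, i.e. the subring of polynomials all of whose monomials have total degree divisible by $\ell$. Let $F_*R$ denote the $R$-module obtained from $R$ by restriction of scalars along the Frobenius endomorphism $F\colon R\to R$, $r\mapsto r^p$. Then $F_*R$ is a finitely generated $R$-module and, regarded as a complex concentrated in degree $0$, it is a strong generator for $\mathsf{D}^{\mathrm b}(\operatorname{mod} R)$, the bounded derived category of finitely generated $R$-modules: there is an integer $n$ such that every object of $\mathsf{D}^{\mathrm b}(\operatorname{mod} R)$ can be obtained from $F_*R$ using shifts, finite direct sums, direct summands (retracts) and at most $n$ extensions (exact triangles). -/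

import Mathlib

open CategoryTheory

universe u w

/-- The `ℓ`-th Veronese subring of the standard graded polynomial ring `k[x_i | i ∈ σ]`: the
polynomials all of whose monomials have total degree divisible by `ℓ`. -/
def veroneseSubalgebra (σ : Type) (k : Type u) [CommRing k] (ℓ : ℕ) :
    Subalgebra k (MvPolynomial σ k) where
  carrier := {f | ∀ d ∈ f.support, ℓ ∣ d.degree}
  mul_mem' := by
    classical
    intro f g hf hg d hd
    obtain ⟨a, ha, b, hb, rfl⟩ := Finset.mem_add.mp (MvPolynomial.support_mul f g hd)
    rw [map_add]
    exact dvd_add (hf a ha) (hg b hb)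
  add_mem' := by
    classical
    intro f g hf hg d hd
    rcases Finset.mem_union.mp (MvPolynomial.support_add hd) with h | h
    · exact hf d h
    · exact hg d h
  algebraMap_mem' := by
    classical
    intro r d hd
    rw [MvPolynomial.algebraMap_eq, MvPolynomial.mem_support_iff, MvPolynomial.coeff_C] at hd
    have h0 : d = 0 := by
      by_contra h
      exact hd (if_neg (Ne.symm h))
    simp [h0]

/-- The `ℓ`-th Veronese subring of `k[x, y]`, as a ring. -/
abbrev VeroneseRing (k : Type u) [CommRing k] (ℓ : ℕ) : Type u :=
  veroneseSubalgebra (Fin 2) k ℓ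

instance VeroneseRing.charP (k : Type u) [CommRing k] (ℓ p : ℕ) [CharP k p] :
    CharP (VeroneseRing k ℓ) p :=
  CharP.subring' (MvPolynomial (Fin 2) k) p (veroneseSubalgebra (Fin 2) k ℓ).toSubring

/-- The Veronese subring is noetherian, so that finitely generated modules over it form an
abelian category. -/
instance VeroneseRing.isNoetherianRing (k : Type u) [Field k] (ℓ : ℕ) :
    IsNoetherianRing (VeroneseRing k ℓ) := by
  rcases Nat.eq_zero_or_pos ℓ with rfl | hℓ
  · refine isNoetherianRing_of_surjective k (VeroneseRing k 0)
      (algebraMap k (VeroneseRing k 0)) ?_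
    rintro ⟨f, hf⟩
    refine ⟨f.coeff 0, Subtype.ext ?_⟩
    change MvPolynomial.C (f.coeff 0) = f
    ext d
    rw [MvPolynomial.coeff_C]
    split_ifs with h
    · rw [h]
    · by_contra hd
      have h1 := hf d (MvPolynomial.mem_support_iff.mpr (Ne.symm hd))
      rw [zero_dvd_iff, Finsupp.degree_eq_zero_iff] at h1
      exact h h1.symm
  · have hX : ∀ i : Fin 2, (MvPolynomial.X i ^ ℓ : MvPolynomial (Fin 2) k) ∈
        veroneseSubalgebra (Fin 2) k ℓ := by
      intro i d hd
      rw [MvPolynomial.X_pow_eq_monomial] at hd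
      have h := Finset.mem_singleton.mp (MvPolynomial.support_monomial_subset hd)
      simp [h]
    have hint : Algebra.IsIntegral (VeroneseRing k ℓ) (MvPolynomial (Fin 2) k) := by
      refine ⟨fun f => ?_⟩
      induction f using MvPolynomial.induction_on with
      | C a => exact isIntegral_algebraMap (x := algebraMap k (VeroneseRing k ℓ) a)
      | add f g hf hg => exact hf.add hg
      | mul_X f i hf =>
        refine hf.mul (IsIntegral.of_pow hℓ ?_)
        exact isIntegral_algebraMap (x := (⟨_, hX i⟩ : VeroneseRing k ℓ))
    have hft : Algebra.FiniteType (VeroneseRing k ℓ) (MvPolynomial (Fin 2) k) :=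
      Algebra.FiniteType.of_restrictScalars_finiteType k _ _
    have hfin : Module.Finite (VeroneseRing k ℓ) (MvPolynomial (Fin 2) k) :=
      Algebra.IsIntegral.finite
    have hk : Algebra.FiniteType k (VeroneseRing k ℓ) :=
      ⟨fg_of_fg_of_fg k (VeroneseRing k ℓ) (MvPolynomial (Fin 2) k)
        (inferInstance : Algebra.FiniteType k (MvPolynomial (Fin 2) k)).out
        hfin.fg_top Subtype.val_injective⟩
    exact Algebra.FiniteType.isNoetherianRing k _

/-- `F_* R`: the ring `R` of characteristic `p`, viewed as a module over itself by restriction of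
scalars along the Frobenius endomorphism. -/
noncomputable def frobeniusPushforward (R : Type u) [CommRing R] (p : ℕ) [ExpChar R p] :
    ModuleCat.{u} R :=
  (ModuleCat.restrictScalars (frobenius R p)).obj (ModuleCat.of R R)

/-- A finitely generated module over a noetherian ring `R`, viewed as a complex concentrated in
degree `0`, as an object of the bounded derived category of finitely generated `R`-modules. -/
noncomputable def boundedDerivedSingle {R : Type u} [CommRing R] [IsNoetherianRing R]
    [HasDerivedCategory.{w} (FGModuleCat.{u} R)] (M : FGModuleCat.{u} R) :
    DerivedCategory.Bounded (FGModuleCat.{u} R) :=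
  ⟨(DerivedCategory.singleFunctor (FGModuleCat.{u} R) 0).obj M,
    ⟨⟨0, inferInstance⟩, ⟨0, inferInstance⟩⟩⟩

/-! Put `S = k[x, y]` and let `S_j` be the span of the monomials of degree `j` modulo `ℓ`; then `R =
S_0`, and `S` is the finite direct sum of the `S_j` over `R`.

`S` generates strongly: since `R` is a direct summand of `S`, a bounded complex `K` over `R` is a
retract of the termwise tensor product `S ⊗ K`. A bounded complex of `S`-modules is an extension of
two complexes with zero differentials (its cycles and the quotient by them), which are sums of
shifted modules. Finitely generated `S`-modules have projective dimension at most 2, so they are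
built from `S` in boundedly many steps (`isStrongTriangulatedGenerator_of_retract`,
`hasProjectiveDimensionLE_mvPolynomial`).

`F_* R` builds `S`: if the exponents of `X ^ c` are less than `p` and its degree is `-p j` modulo
`ℓ`, then `f ↦ f ^ p * X ^ c` embeds `S_j` into `F_* R` as a summand
(`exists_retraction_frobeniusPushforward`). This gives `S_0` and `S_{-1}`. For `j ≠ 0` the Koszul
complex is an exact sequence `0 → S_{j-2} → S_{j-1}² → S_j → 0`, which yields the other parts by
induction (`exists_heartLevel_part`). -/

/-! ### Counting extensions in a triangulated category -/

namespace CategoryTheory.ObjectProperty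

open Limits Pretriangulated

section

variable {C : Type*} [Category* C] (P : ObjectProperty C)

/-- If `P` is closed under products indexed by `J`, so is its closure under retracts. -/
instance isClosedUnderLimitsOfShape_retractClosure {J : Type*} [HasProductsOfShape J C]
    [P.IsClosedUnderLimitsOfShape (Discrete J)] :
    P.retractClosure.IsClosedUnderLimitsOfShape (Discrete J) where
  limitsOfShape_le := by
    rintro X ⟨p⟩
    choose Y hY r using fun j => p.prop_diag_obj (.mk j)
    have e : X ≅ ∏ᶜ fun j => p.diag.obj (.mk j) :=
      IsLimit.conePointUniqueUpToIso
        ((IsLimit.postcomposeHomEquiv Discrete.natIsoFunctor _).symm p.isLimit)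
        (productIsProduct _)
    refine ⟨∏ᶜ Y, P.prop_pi Y hY, ⟨e.retract.trans
      ⟨Limits.Pi.map fun j => (r j).some.i, Limits.Pi.map fun j => (r j).some.r, ?_⟩⟩⟩
    ext j
    simp

end

variable {C : Type*} [Category* C] [HasZeroObject C] [HasShift C ℤ] [Preadditive C]
  [∀ (n : ℤ), (shiftFunctor C n).Additive] [Pretriangulated C] (P Q : ObjectProperty C)

/-- The extension product of properties closed under products indexed by `J` is closed under
products indexed by `J`. -/
instance isClosedUnderLimitsOfShape_extensionProduct {J : Type*} [HasProductsOfShape J C]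
    [P.IsClosedUnderLimitsOfShape (Discrete J)] [Q.IsClosedUnderLimitsOfShape (Discrete J)] :
    (extensionProduct P Q).IsClosedUnderLimitsOfShape (Discrete J) where
  limitsOfShape_le := by
    rintro X ⟨p⟩
    choose Y Z f g h hT hY hZ using fun j => p.prop_diag_obj (.mk j)
    have e : X ≅ ∏ᶜ fun j => p.diag.obj (.mk j) :=
      IsLimit.conePointUniqueUpToIso
        ((IsLimit.postcomposeHomEquiv Discrete.natIsoFunctor _).symm p.isLimit)
        (productIsProduct _)
    refine (extensionProduct P Q).prop_of_iso e.symm ?_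
    exact ⟨_, _, _, _, _, productTriangle_distinguished _ hT, P.prop_pi Y hY, Q.prop_pi Z hZ⟩

instance isClosedUnderLimitsOfShape_extensionProductIter {J : Type*} [HasProductsOfShape J C]
    [P.IsClosedUnderLimitsOfShape (Discrete J)] (n : ℕ) :
    (P.extensionProductIter n).IsClosedUnderLimitsOfShape (Discrete J) := by
  induction n with
  | zero => rw [extensionProductIter_zero]; infer_instance
  | succ n h => rw [extensionProductIter_succ]; infer_instance

lemma triangEnvelopeIter_biprod {n : ℕ} {X Y : C} (hX : P.triangEnvelopeIter n X)
    (hY : P.triangEnvelopeIter n Y) : P.triangEnvelopeIter n (X ⊞ Y) :=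
  (P.triangEnvelopeIter n).prop_of_isLimit_binaryFan (BinaryBiproduct.isLimit X Y) hX hY

/-- Level `n` allows `n` extensions, hence `n + 1` factors; joining `n + 1` and `m + 1` factors
takes `n + m + 1` extensions. -/
lemma triangEnvelopeIter_of_distinguished [IsTriangulated C] {n m : ℕ} (T : Triangle C)
    (hT : T ∈ distTriang C) (h₁ : P.triangEnvelopeIter n T.obj₁)
    (h₃ : P.triangEnvelopeIter m T.obj₃) : P.triangEnvelopeIter (n + m + 1) T.obj₂ := by
  rw [add_assoc, triangEnvelopeIter_add' P rfl]
  exact le_retractClosure _ _ ⟨_, _, _, _, _, hT, h₁, h₃⟩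

lemma triangEnvelopeIter_of_distinguished₃ [IsTriangulated C] {n m : ℕ} (T : Triangle C)
    (hT : T ∈ distTriang C) (h₁ : P.triangEnvelopeIter n T.obj₁)
    (h₂ : P.triangEnvelopeIter m T.obj₂) : P.triangEnvelopeIter (m + n + 1) T.obj₃ :=
  P.triangEnvelopeIter_of_distinguished _ (rot_of_distTriang _ hT) h₂
    ((P.triangEnvelopeIter n).le_shift 1 _ h₁)

/-- If the identity of `X` is a finite sum of morphisms which factor through objects of
`P.triangEnvelopeIter n`, then `X` is in `P.triangEnvelopeIter n`. -/
lemma triangEnvelopeIter_of_sum_eq_id (hP : P.Nonempty) {n : ℕ} {ι : Type*} (s : Finset ι) {X : C}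
    (Y : ι → C) (hY : ∀ i, P.triangEnvelopeIter n (Y i)) (a : ∀ i, X ⟶ Y i) (b : ∀ i, Y i ⟶ X)
    (h : ∑ i ∈ s, a i ≫ b i = 𝟙 X) : P.triangEnvelopeIter n X := by
  classical
  have : (P.triangEnvelopeIter n).Nonempty := .mono (P.le_triangEnvelopeIter n)
  -- The identity is not a partial sum, so the induction proves that every partial sum factors
  -- through a single object of level `n`.
  suffices ∃ (Z : C) (_ : P.triangEnvelopeIter n Z) (i : X ⟶ Z) (r : Z ⟶ X),
      i ≫ r = ∑ i ∈ s, a i ≫ b i by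
    obtain ⟨Z, hZ, i, r, hir⟩ := this
    exact (P.triangEnvelopeIter n).prop_of_retract ⟨i, r, hir.trans h⟩ hZ
  clear h
  induction s using Finset.induction_on with
  | empty =>
    obtain ⟨Z, _, hZ⟩ := (P.triangEnvelopeIter n).exists_prop_of_containsZero
    exact ⟨Z, hZ, 0, 0, by simp⟩
  | insert j s hj ih =>
    obtain ⟨Z, hZ, i, r, hir⟩ := ih
    exact ⟨Y j ⊞ Z, P.triangEnvelopeIter_biprod (hY j) hZ, biprod.lift (a j) i,
      biprod.desc (b j) r, by rw [biprod.lift_desc, Finset.sum_insert hj, hir]⟩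

/-- A distinguished triangle whose vertices lie in a full triangulated subcategory is
distinguished in this subcategory. -/
lemma exists_distinguished_of_isTriangulated [P.IsTriangulated] {X Y Z : P.FullSubcategory}
    (f : X.obj ⟶ Y.obj) (g : Y.obj ⟶ Z.obj) (h : Z.obj ⟶ X.obj⟦(1 : ℤ)⟧)
    (hT : Triangle.mk f g h ∈ distTriang C) :
    ∃ h', Triangle.mk (homMk f : X ⟶ Y) (homMk g : Y ⟶ Z) h' ∈ distTriang P.FullSubcategory :=
  -- `h` ends in the shift of the ambient category and is moved to the shift of the subcategory.
  ⟨P.fullyFaithfulι.preimage (h ≫ (P.ι.commShiftIso (1 : ℤ)).inv.app X),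
    isomorphic_distinguished _ hT _ (Triangle.isoMk _ _ (Iso.refl _) (Iso.refl _) (Iso.refl _)
      ((Category.comp_id _).trans (Category.id_comp _).symm)
      ((Category.comp_id _).trans (Category.id_comp _).symm) (by
        refine Eq.trans ?_ (Category.id_comp _).symm
        change ((h ≫ (P.ι.commShiftIso (1 : ℤ)).inv.app X) ≫
          (P.ι.commShiftIso (1 : ℤ)).hom.app X) ≫ (𝟙 X.obj)⟦(1 : ℤ)⟧' = h
        refine (congrArg (_ ≫ ·) ((shiftFunctor C (1 : ℤ)).map_id X.obj)).trans ?_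
        refine (Category.comp_id _).trans ((Category.assoc _ _ _).trans ?_)
        exact (congrArg (h ≫ ·) ((P.ι.commShiftIso (1 : ℤ)).inv_hom_id_app X)).trans
          (Category.comp_id h)))⟩

end CategoryTheory.ObjectProperty

/-! ### Modules and complexes with zero differentials in the bounded derived category -/

namespace DerivedCategory

open Limits Pretriangulated TStructure ObjectProperty

variable {A : Type*} [Category* A] [Abelian A] [HasDerivedCategory A]

lemma bounded_Q_obj (K : CochainComplex A ℤ) (a b : ℤ) [K.IsStrictlyGE a] [K.IsStrictlyLE b] :
    t.bounded (Q.obj K) :=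
  ⟨⟨a, inferInstance⟩, ⟨b, inferInstance⟩⟩

/-- The functor which sends an object to the corresponding complex concentrated in degree `n`,
in the bounded derived category. -/
noncomputable abbrev Bounded.singleFunctor (n : ℤ) : A ⥤ Bounded A :=
  t.bounded.lift (DerivedCategory.singleFunctor A n)
    fun _ => ⟨⟨n, inferInstance⟩, ⟨n, inferInstance⟩⟩

/-- Up to a shift, complexes concentrated in one degree do not depend on this degree. -/
noncomputable def Bounded.shiftSingleIso (M : A) (n : ℤ) :
    ((Bounded.singleFunctor 0).obj M)⟦-n⟧ ≅ (Bounded.singleFunctor n).obj M :=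
  t.bounded.isoMk ((t.bounded.ι.commShiftIso (-n)).app ((Bounded.singleFunctor 0).obj M) ≪≫
    ((singleFunctors A).shiftIso (-n) n 0 (by simp)).app M)

variable (P : ObjectProperty (Bounded A))

/-- The objects of an abelian category which, as complexes concentrated in degree `0`, are built
from `P` with at most `n` extensions. -/
def heartLevel (n : ℕ) : ObjectProperty A :=
  fun M => P.triangEnvelopeIter n ((Bounded.singleFunctor 0).obj M)

variable {P} {n m : ℕ}

instance : (heartLevel P n).IsStableUnderRetracts where
  of_retract r h := (P.triangEnvelopeIter n).prop_of_retract (r.map (Bounded.singleFunctor 0)) h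

lemma heartLevel_of_sum_eq_id (hP : P.Nonempty) {ι : Type*} (s : Finset ι) {X : A} (Y : ι → A)
    (hY : ∀ i, heartLevel P n (Y i)) (a : ∀ i, X ⟶ Y i) (b : ∀ i, Y i ⟶ X)
    (h : ∑ i ∈ s, a i ≫ b i = 𝟙 X) : heartLevel P n X := by
  refine P.triangEnvelopeIter_of_sum_eq_id hP s _ hY (fun i => (Bounded.singleFunctor 0).map (a i))
    (fun i => (Bounded.singleFunctor 0).map (b i)) ?_
  apply t.bounded.ι.map_injective
  rw [Functor.map_sum]
  refine Eq.trans ?_ (congrArg (DerivedCategory.singleFunctor A 0).map h |>.trans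
    (CategoryTheory.Functor.map_id _ _))
  rw [Functor.map_sum]
  refine Finset.sum_congr rfl fun i _ => ?_
  rw [Functor.map_comp (DerivedCategory.singleFunctor A 0)]
  rfl

lemma exists_bounded_single_distinguished {S : ShortComplex A} (hS : S.ShortExact) :
    ∃ h, Triangle.mk ((Bounded.singleFunctor 0).map S.f) ((Bounded.singleFunctor 0).map S.g) h ∈
      distTriang (Bounded A) :=
  t.bounded.exists_distinguished_of_isTriangulated
    (X := (Bounded.singleFunctor 0).obj S.X₁) (Y := (Bounded.singleFunctor 0).obj S.X₂)
    (Z := (Bounded.singleFunctor 0).obj S.X₃) _ _ _ hS.singleTriangle_distinguished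

lemma heartLevel_of_shortExact₃ {S : ShortComplex A} (hS : S.ShortExact)
    (h₁ : heartLevel P n S.X₁) (h₂ : heartLevel P m S.X₂) : heartLevel P (m + n + 1) S.X₃ :=
  P.triangEnvelopeIter_of_distinguished₃ _ (exists_bounded_single_distinguished hS).choose_spec
    h₁ h₂

lemma heartLevel_mono (h : n ≤ m) {X : A} (hX : heartLevel P n X) : heartLevel P m X :=
  P.monotone'_triangEnvelopeIter h _ hX

lemma triangEnvelopeIter_of_shortExact {S : ShortComplex (CochainComplex A ℤ)} (hS : S.ShortExact)
    (b₁ : t.bounded (Q.obj S.X₁)) (b₂ : t.bounded (Q.obj S.X₂)) (b₃ : t.bounded (Q.obj S.X₃))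
    (h₁ : P.triangEnvelopeIter n ⟨_, b₁⟩) (h₃ : P.triangEnvelopeIter m ⟨_, b₃⟩) :
    P.triangEnvelopeIter (n + m + 1) ⟨_, b₂⟩ := by
  obtain ⟨h, hT⟩ := t.bounded.exists_distinguished_of_isTriangulated
    (X := ⟨_, b₁⟩) (Y := ⟨_, b₂⟩) (Z := ⟨_, b₃⟩) _ _ _ (triangleOfSES_distinguished hS)
  exact P.triangEnvelopeIter_of_distinguished _ hT h₁ h₃

/-- A bounded complex with zero differentials is built from `P` in as many steps as its
components. -/
lemma triangEnvelopeIter_of_d_eq_zero (hP : P.Nonempty) (N : CochainComplex A ℤ)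
    (hd : ∀ i j, N.d i j = 0) (a b : ℤ) [N.IsStrictlyGE a] [N.IsStrictlyLE b]
    (hN : ∀ i, heartLevel P n (N.X i)) (hb : t.bounded (Q.obj N)) :
    P.triangEnvelopeIter n ⟨Q.obj N, hb⟩ := by
  -- Because the differentials vanish, projections to and inclusions of single components are chain
  -- maps.
  let pr (i : ℤ) : N ⟶ (HomologicalComplex.single A (.up ℤ) i).obj (N.X i) :=
    HomologicalComplex.mkHomToSingle (𝟙 _) fun j _ => by simp [hd]
  let inc (i : ℤ) : (HomologicalComplex.single A (.up ℤ) i).obj (N.X i) ⟶ N :=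
    HomologicalComplex.mkHomFromSingle (𝟙 _) fun j _ => by simp [hd]
  have hsum : ∑ i ∈ Finset.Icc a b, pr i ≫ inc i = 𝟙 N := by
    ext j
    refine (map_sum (HomologicalComplex.Hom.fAddMonoidHom (C₁ := N) (C₂ := N) j) _ _).trans ?_
    simp only [HomologicalComplex.Hom.fAddMonoidHom_apply]
    by_cases hj : j ∈ Finset.Icc a b
    · rw [Finset.sum_eq_single_of_mem j hj]
      · rw [HomologicalComplex.comp_f, HomologicalComplex.mkHomToSingle_f,
          HomologicalComplex.mkHomFromSingle_f]
        simp
      · intro i _ hij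
        rw [HomologicalComplex.comp_f]
        exact ((HomologicalComplex.isZero_single_obj_X (.up ℤ) i (N.X i) j hij.symm).eq_of_tgt
          ((pr i).f j) 0).symm ▸ zero_comp
    · refine IsZero.eq_of_src ?_ _ _
      rw [Finset.mem_Icc, not_and_or, not_le, not_le] at hj
      rcases hj with hj | hj
      · exact N.isZero_of_isStrictlyGE a j hj
      · exact N.isZero_of_isStrictlyLE b j hj
  refine P.triangEnvelopeIter_of_sum_eq_id hP (Finset.Icc a b)
    (fun i => (Bounded.singleFunctor i).obj (N.X i))
    (fun i => (P.triangEnvelopeIter n).prop_of_iso (Bounded.shiftSingleIso _ i)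
      ((P.triangEnvelopeIter n).le_shift (-i) _ (hN i)))
    (fun i => homMk (Q.map (pr i))) (fun i => homMk (Q.map (inc i))) ?_
  apply t.bounded.ι.map_injective
  rw [Functor.map_sum]
  refine Eq.trans ?_ ((congrArg Q.map hsum).trans (CategoryTheory.Functor.map_id _ _))
  rw [Functor.map_sum]
  refine Finset.sum_congr rfl fun i _ => ?_
  rw [Functor.map_comp Q]
  rfl

end DerivedCategory

/-! ### The cycles as a subcomplex with zero differentials -/

namespace CochainComplex

open Limits HomologicalComplex

variable {B : Type*} [Category* B] [Abelian B]

/-- The complex of cycles of a complex, with zero differentials. -/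
@[simps]
noncomputable def cyclesComplex (L : CochainComplex B ℤ) : CochainComplex B ℤ where
  X i := L.cycles i
  d _ _ := 0

/-- The inclusion of the complex of cycles. -/
@[simps]
noncomputable def cyclesComplexι (L : CochainComplex B ℤ) : cyclesComplex L ⟶ L where
  f i := L.iCycles i
  comm' i j _ := (L.iCycles_d i j).trans zero_comp.symm

instance (L : CochainComplex B ℤ) : Mono (cyclesComplexι L) :=
  HomologicalComplex.mono_of_mono_f _ fun i => inferInstanceAs (Mono (L.iCycles i))

/-- The short exact sequence which presents a complex as an extension of complexes with zero
differentials. -/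
@[simps]
noncomputable def cyclesShortComplex (L : CochainComplex B ℤ) :
    ShortComplex (CochainComplex B ℤ) where
  f := cyclesComplexι L
  g := cokernel.π (cyclesComplexι L)
  zero := cokernel.condition _

lemma cyclesShortComplex_shortExact (L : CochainComplex B ℤ) :
    (cyclesShortComplex L).ShortExact where
  exact := ShortComplex.exact_of_g_is_cokernel _ (cokernelIsCokernel _)
  mono_f := inferInstanceAs (Mono (cyclesComplexι L))
  epi_g := coequalizer.π_epi

/-- The differential factors through the cycles, which die in the quotient. -/
lemma d_cokernel_cyclesComplexι (L : CochainComplex B ℤ) (i j : ℤ) :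
    (cokernel (cyclesComplexι L)).d i j = 0 := by
  have : Epi (cokernel.π (cyclesComplexι L)) := coequalizer.π_epi
  have : Epi ((cokernel.π (cyclesComplexι L)).f i) :=
    inferInstanceAs (Epi ((eval B (.up ℤ) i).map (cokernel.π (cyclesComplexι L))))
  rw [← cancel_epi ((cokernel.π (cyclesComplexι L)).f i), Hom.comm, comp_zero,
    ← L.toCycles_i i j, Category.assoc]
  have : L.iCycles j ≫ (cokernel.π (cyclesComplexι L)).f j = 0 :=
    congrArg (Hom.f · j) (cokernel.condition (cyclesComplexι L))
  rw [this, comp_zero]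

lemma isStrictlyGE_of_shortExact {S : ShortComplex (CochainComplex B ℤ)} (hS : S.ShortExact)
    (a : ℤ) [S.X₂.IsStrictlyGE a] : S.X₁.IsStrictlyGE a ∧ S.X₃.IsStrictlyGE a := by
  have h := (shortExact_iff_degreewise_shortExact S).1 hS
  simp only [isStrictlyGE_iff]
  constructor <;> intro i hi <;> have h0 := S.X₂.isZero_of_isStrictlyGE a i hi
  · have : Mono (S.f.f i) := (h i).mono_f
    exact IsZero.of_mono (S.f.f i) h0
  · have : Epi (S.g.f i) := (h i).epi_g
    exact IsZero.of_epi (S.g.f i) h0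

lemma isStrictlyLE_of_shortExact {S : ShortComplex (CochainComplex B ℤ)} (hS : S.ShortExact)
    (a : ℤ) [S.X₂.IsStrictlyLE a] : S.X₁.IsStrictlyLE a ∧ S.X₃.IsStrictlyLE a := by
  have h := (shortExact_iff_degreewise_shortExact S).1 hS
  simp only [isStrictlyLE_iff]
  constructor <;> intro i hi <;> have h0 := S.X₂.isZero_of_isStrictlyLE a i hi
  · have : Mono (S.f.f i) := (h i).mono_f
    exact IsZero.of_mono (S.f.f i) h0
  · have : Epi (S.g.f i) := (h i).epi_g
    exact IsZero.of_epi (S.g.f i) h0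

end CochainComplex

/-! ### Strong generation through a split exact functor -/

namespace DerivedCategory

open Limits Pretriangulated TStructure ObjectProperty

variable {A : Type*} [Category* A] [Abelian A] [HasDerivedCategory A]
  {B : Type*} [Category* B] [Abelian B]

/-- If every object in the image of an exact functor `F` is built from `P` with at most `n`
extensions, then so are, up to doubling, the images of all bounded complexes. -/
lemma triangEnvelopeIter_map (F : B ⥤ A) [F.Additive] [PreservesFiniteLimits F]
    [PreservesFiniteColimits F] {P : ObjectProperty (Bounded A)} (hP : P.Nonempty) {n : ℕ}
    (hF : ∀ M, heartLevel P n (F.obj M)) (L : CochainComplex B ℤ) (a b : ℤ) [L.IsStrictlyGE a]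
    [L.IsStrictlyLE b] (hb : t.bounded (Q.obj ((F.mapHomologicalComplex (.up ℤ)).obj L))) :
    P.triangEnvelopeIter (n + n + 1) ⟨_, hb⟩ := by
  have hS := CochainComplex.cyclesShortComplex_shortExact L
  have : (CochainComplex.cyclesShortComplex L).X₂.IsStrictlyGE a := ‹L.IsStrictlyGE a›
  have : (CochainComplex.cyclesShortComplex L).X₂.IsStrictlyLE b := ‹L.IsStrictlyLE b›
  obtain ⟨_, _⟩ := CochainComplex.isStrictlyGE_of_shortExact hS a
  obtain ⟨_, _⟩ := CochainComplex.isStrictlyLE_of_shortExact hS b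
  -- Cycles are taken in `B`, before applying `F`: both outer complexes then have all components in
  -- the image of `F`, and the bound does not depend on the length of `L`.
  refine triangEnvelopeIter_of_shortExact (hS.map_of_exact (F.mapHomologicalComplex (.up ℤ)))
    (bounded_Q_obj ((F.mapHomologicalComplex _).obj _) a b) hb
    (bounded_Q_obj ((F.mapHomologicalComplex _).obj _) a b) ?_ ?_
  · refine triangEnvelopeIter_of_d_eq_zero (N := (F.mapHomologicalComplex (.up ℤ)).obj _) hP
      (fun i j => ?_) a b (fun i => hF _) _
    exact F.map_zero _ _
  · refine triangEnvelopeIter_of_d_eq_zero (N := (F.mapHomologicalComplex (.up ℤ)).obj _) hP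
      (fun i j => ?_) a b (fun i => hF _) _
    exact (congrArg F.map (CochainComplex.d_cokernel_cyclesComplexι L i j)).trans (F.map_zero _ _)

/-- Let `F` be an exact functor and `G` an additive functor in the opposite direction such that
the identity is a retract of `G ⋙ F`. If all objects in the image of `F` are built from `P` with a
bounded number of extensions, then `P` is a strong generator. -/
theorem isStrongTriangulatedGenerator_of_retract (F : B ⥤ A) [F.Additive]
    [PreservesFiniteLimits F] [PreservesFiniteColimits F] (G : A ⥤ B) [G.Additive]
    (η : 𝟭 A ⟶ G ⋙ F) (ρ : G ⋙ F ⟶ 𝟭 A) (hηρ : η ≫ ρ = 𝟙 _)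
    {P : ObjectProperty (Bounded A)} (hP : P.Nonempty) {n : ℕ}
    (hF : ∀ M, heartLevel P n (F.obj M)) : P.IsStrongTriangulatedGenerator := by
  refine ⟨n + n + 1, eq_top_iff.2 ?_⟩
  rintro ⟨X, ⟨a, ha⟩, ⟨b, hb⟩⟩ -
  have : X.IsGE a := ha
  have : X.IsLE b := hb
  obtain ⟨K, _, _, ⟨e⟩⟩ := exists_iso_Q_obj_of_isGE_of_isLE X a b
  -- `G` is applied termwise to an actual complex, so it need not be exact; naturality makes the
  -- termwise retraction a retraction of complexes.
  let L := (G.mapHomologicalComplex (.up ℤ)).obj K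
  let K' := (F.mapHomologicalComplex (.up ℤ)).obj L
  let i : K ⟶ K' :=
    { f := fun j => η.app (K.X j)
      comm' := fun j k _ => (η.naturality (K.d j k)).symm }
  let r : K' ⟶ K :=
    { f := fun j => ρ.app (K.X j)
      comm' := fun j k _ => (ρ.naturality (K.d j k)).symm }
  have hir : i ≫ r = 𝟙 K := by
    ext j
    exact NatTrans.congr_app hηρ (K.X j)
  have hK' : t.bounded (Q.obj K') := bounded_Q_obj K' a b
  refine (P.triangEnvelopeIter _).prop_of_retract
    (Y := ⟨Q.obj K', hK'⟩) ⟨homMk (e.hom ≫ Q.map i), homMk (Q.map r ≫ e.inv), ?_⟩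
    (triangEnvelopeIter_map F hP hF L a b hK')
  ext
  change (e.hom ≫ Q.map i) ≫ (Q.map r ≫ e.inv) = 𝟙 X
  rw [Category.assoc, ← Category.assoc (Q.map i), ← Functor.map_comp, hir]
  simp

end DerivedCategory

/-! ### Restriction and extension of scalars for finitely generated modules -/

namespace FGModuleCat

open Limits TensorProduct

section

variable {R : Type u} [Ring R] [IsNoetherianRing R]

lemma shortExact_of_exact {X Y Z : FGModuleCat.{u} R} (f : X ⟶ Y) (g : Y ⟶ Z) (w : f ≫ g = 0)
    (hf : Function.Injective f.hom.hom) (hfg : Function.Exact f.hom.hom g.hom.hom)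
    (hg : Function.Surjective g.hom.hom) : (ShortComplex.mk f g w).ShortExact := by
  have h : ((ShortComplex.mk f g w).map (forget₂ (FGModuleCat R) (ModuleCat R))).ShortExact :=
    ModuleCat.shortComplex_shortExact _ hfg hf hg
  have := h.mono_f
  have := h.epi_g
  exact
    { exact := (ShortComplex.exact_map_iff_of_faithful (ShortComplex.mk f g w)
        (forget₂ (FGModuleCat R) (ModuleCat R))).1 h.exact
      mono_f := (forget₂ (FGModuleCat R) (ModuleCat R)).mono_of_mono_map h.mono_f
      epi_g := (forget₂ (FGModuleCat R) (ModuleCat R)).epi_of_epi_map h.epi_g }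

end

variable (R S : Type u) [CommRing R] [CommRing S] [Algebra R S] [Module.Finite R S]

/-- Restriction of scalars of finitely generated modules along a finite ring homomorphism. -/
noncomputable abbrev restrictScalars : FGModuleCat.{u} S ⥤ FGModuleCat.{u} R :=
  (ModuleCat.isFG R).lift ((ModuleCat.isFG S).ι ⋙ ModuleCat.restrictScalars (algebraMap R S))
    fun M => by
      let : Module R M.obj := Module.compHom _ (algebraMap R S)
      have : IsScalarTower R S M.obj := ⟨fun r s m => by
        rw [Algebra.smul_def, mul_smul]; rfl⟩
      have : Module.Finite R M.obj := Module.Finite.trans S M.obj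
      exact this

instance : (restrictScalars R S).Additive where

instance [IsNoetherianRing R] [IsNoetherianRing S] :
    PreservesFiniteLimits (restrictScalars R S) where
  preservesFiniteLimits J _ _ := by
    have : PreservesLimitsOfShape J (ModuleCat.restrictScalars.{u} (algebraMap R S)) :=
      ⟨inferInstance⟩
    have : PreservesLimitsOfShape J (restrictScalars R S ⋙ forget₂ (FGModuleCat R) (ModuleCat R)) :=
      comp_preservesLimitsOfShape (forget₂ (FGModuleCat S) (ModuleCat S))
        (ModuleCat.restrictScalars (algebraMap R S))
    exact preservesLimitsOfShape_of_reflects_of_preserves _ (forget₂ (FGModuleCat R) (ModuleCat R))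

instance [IsNoetherianRing R] [IsNoetherianRing S] :
    PreservesFiniteColimits (restrictScalars R S) where
  preservesFiniteColimits J _ _ := by
    have : PreservesColimitsOfShape J (ModuleCat.restrictScalars.{u} (algebraMap R S)) :=
      ⟨inferInstance⟩
    have : PreservesColimitsOfShape J
        (restrictScalars R S ⋙ forget₂ (FGModuleCat R) (ModuleCat R)) :=
      comp_preservesColimitsOfShape (forget₂ (FGModuleCat S) (ModuleCat S))
        (ModuleCat.restrictScalars (algebraMap R S))
    exact preservesColimitsOfShape_of_reflects_of_preserves _
      (forget₂ (FGModuleCat R) (ModuleCat R))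

/-- Extension of scalars of finitely generated modules. -/
noncomputable abbrev baseChange : FGModuleCat.{u} R ⥤ FGModuleCat.{u} S where
  obj M := .of S (S ⊗[R] M)
  map f := ofHom (f.hom.hom.baseChange S)
  map_id M := by
    ext : 1
    exact LinearMap.baseChange_id
  map_comp f g := by
    ext : 1
    exact LinearMap.baseChange_comp _ _

instance : (baseChange R S).Additive where
  map_add {_ _ f g} := by
    ext : 1
    exact LinearMap.baseChange_add f.hom.hom g.hom.hom

/-- The canonical morphism `M ⟶ S ⊗[R] M`. -/
noncomputable def toBaseChange : 𝟭 (FGModuleCat.{u} R) ⟶ baseChange R S ⋙ restrictScalars R S where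
  app M := ObjectProperty.homMk (ModuleCat.ofHom
    (Y := ((baseChange R S ⋙ restrictScalars R S).obj M).obj)
    { toFun m := (1 : S) ⊗ₜ[R] (m : M)
      map_add' := fun m m' => tmul_add _ _ _
      map_smul' := fun r m => (tmul_smul r (1 : S) (m : M)).trans
        (algebraMap_smul S r ((1 : S) ⊗ₜ[R] (m : M))).symm })
  naturality M N f := by
    ext m
    rfl

/-- The morphism `S ⊗[R] M ⟶ M` induced by a linear form on `S`. -/
noncomputable def ofBaseChange (π : S →ₗ[R] R) :
    baseChange R S ⋙ restrictScalars R S ⟶ 𝟭 (FGModuleCat.{u} R) where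
  app M := ObjectProperty.homMk (ModuleCat.ofHom
    (X := ((baseChange R S ⋙ restrictScalars R S).obj M).obj)
    { toFun x := TensorProduct.lid R M (π.rTensor M x)
      map_add' := fun x y => by
        exact (congrArg _ (map_add (π.rTensor M) x y)).trans (map_add (TensorProduct.lid R M) _ _)
      map_smul' := fun r x => by
        refine (congrArg (fun y => TensorProduct.lid R M (π.rTensor M y))
          (algebraMap_smul S r (show S ⊗[R] M from x))).trans ?_
        rw [map_smul, map_smul]
        rfl })
  naturality M N f := by
    apply FGModuleCat.hom_ext
    apply LinearMap.ext
    intro (x : S ⊗[R] M)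
    change TensorProduct.lid R N (π.rTensor N (f.hom.hom.baseChange S x)) =
      f.hom.hom (TensorProduct.lid R M (π.rTensor M x))
    induction x using TensorProduct.induction_on with
    | zero => simp
    | tmul s m => simp
    | add x y hx hy => simp only [map_add, hx, hy]

lemma toBaseChange_comp_ofBaseChange (π : S →ₗ[R] R) (hπ : π 1 = 1) :
    toBaseChange R S ≫ ofBaseChange R S π = 𝟙 _ := by
  ext M m
  change TensorProduct.lid R M (π.rTensor M ((1 : S) ⊗ₜ[R] (m : M))) = m
  simp [hπ]

end FGModuleCat

/-! ### Strong generation from a split finite algebra of finite global dimension -/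

namespace DerivedCategory

open Limits TensorProduct ObjectProperty

variable (R S : Type u) [CommRing R] [CommRing S] [Algebra R S] [Module.Finite R S]
  [IsNoetherianRing R] [HasDerivedCategory.{w} (FGModuleCat.{u} R)]

variable {R S} {P : ObjectProperty (Bounded (FGModuleCat.{u} R))}

/-- A finitely generated projective is a retract of some `S ^ m`, so its identity is a sum of maps
through `S`; this costs no extension. -/
lemma heartLevel_of_projective (hP : P.Nonempty) {n : ℕ}
    (hS : heartLevel P n ((FGModuleCat.restrictScalars R S).obj (.of S S))) (M : FGModuleCat.{u} S)
    [Module.Projective S M] : heartLevel P n ((FGModuleCat.restrictScalars R S).obj M) := by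
  obtain ⟨m, r, i, -, -, hri⟩ := Module.Finite.exists_comp_eq_id_of_projective S M
  let a (j : Fin m) : M ⟶ .of S S := FGModuleCat.ofHom (LinearMap.proj j ∘ₗ i)
  let b (j : Fin m) : .of S S ⟶ M := FGModuleCat.ofHom (r ∘ₗ LinearMap.single S (fun _ => S) j)
  refine heartLevel_of_sum_eq_id hP Finset.univ (fun _ => _) (fun _ => hS)
    (fun j => (FGModuleCat.restrictScalars R S).map (a j))
    (fun j => (FGModuleCat.restrictScalars R S).map (b j)) ?_
  simp_rw [← Functor.map_comp]
  rw [← Functor.map_sum, ← CategoryTheory.Functor.map_id]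
  congr 1
  apply FGModuleCat.hom_ext
  ext x
  have h1 : (∑ j, a j ≫ b j).hom.hom = ∑ j, (a j ≫ b j).hom.hom :=
    map_sum (⟨⟨fun f : M ⟶ M => f.hom.hom, rfl⟩, fun _ _ => rfl⟩ : (M ⟶ M) →+ (M →ₗ[S] M)) _ _
  rw [h1, LinearMap.sum_apply]
  change ∑ j, r (Pi.single j (i x j)) = x
  rw [← map_sum, Finset.univ_sum_single]
  exact LinearMap.congr_fun hri x

variable [IsNoetherianRing S]

/-- Induction on syzygies: each step adds a free module of level `n` and one extension, hence `n +
1`. -/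
lemma heartLevel_of_hasProjectiveDimensionLE (hP : P.Nonempty) {n : ℕ}
    (hS : heartLevel P n ((FGModuleCat.restrictScalars R S).obj (.of S S))) (d : ℕ)
    (M : FGModuleCat.{u} S) (hM : HasProjectiveDimensionLE M.obj d) :
    heartLevel P (n + d * (n + 1)) ((FGModuleCat.restrictScalars R S).obj M) := by
  induction d generalizing M with
  | zero =>
    have : Projective M.obj := (projective_iff_hasProjectiveDimensionLE_zero _).2 hM
    have : Module.Projective S M := (IsProjective.iff_projective _).2 this
    simpa using heartLevel_of_projective hP hS M
  | succ d ih =>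
    obtain ⟨m, f, hf⟩ := Module.Finite.exists_fin' S M
    have h1 := LinearMap.shortExact_shortComplexKer hf
    have : Projective (LinearMap.shortComplexKer f).X₂ :=
      inferInstanceAs (Projective (ModuleCat.of S (Fin m → S)))
    have h2 := ih (FGModuleCat.of S f.ker) ((h1.hasProjectiveDimensionLT_X₃_iff d this).1 hM)
    have h3 : (ShortComplex.mk (FGModuleCat.ofHom f.ker.subtype)
        (FGModuleCat.ofHom f : _ ⟶ M) (by ext x; exact x.2)).ShortExact :=
      FGModuleCat.shortExact_of_exact _ _ _ Subtype.val_injective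
        (LinearMap.exact_subtype_ker_map f) hf
    have h4 := heartLevel_of_shortExact₃ (h3.map_of_exact (FGModuleCat.restrictScalars R S)) h2
      (heartLevel_of_projective hP hS (FGModuleCat.of S (Fin m → S)))
    rwa [show n + (d + 1) * (n + 1) = n + (n + d * (n + 1)) + 1 by ring]

/-- Let `S` be a finite `R`-algebra such that `R` is a direct summand of `S` and finitely generated
`S`-modules have projective dimension at most `d`. If `S` is built from `P` in finitely many
steps, then `P` is a strong generator of the bounded derived category of `R`. -/
theorem isStrongTriangulatedGenerator_of_split (hP : P.Nonempty) (π : S →ₗ[R] R) (hπ : π 1 = 1)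
    (d : ℕ) (hd : ∀ M : FGModuleCat.{u} S, HasProjectiveDimensionLE M.obj d) {n : ℕ}
    (hS : heartLevel P n ((FGModuleCat.restrictScalars R S).obj (.of S S))) :
    P.IsStrongTriangulatedGenerator :=
  isStrongTriangulatedGenerator_of_retract (FGModuleCat.restrictScalars R S)
    (FGModuleCat.baseChange R S) _ _ (FGModuleCat.toBaseChange_comp_ofBaseChange R S π hπ) hP
    fun M => heartLevel_of_hasProjectiveDimensionLE hP hS d M (hd M)

end DerivedCategory

/-! ### The two-term resolution of an `A[X]`-module by extended modules -/

section PolynomialExact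

open Polynomial TensorProduct

variable {A M : Type*} [CommRing A] [AddCommGroup M] [Module A M] [Module A[X] M]
  [IsScalarTower A A[X] M]

variable (A M) in
/-- The difference of the two actions of the variable on `A[X] ⊗[A] M`. -/
noncomputable def Polynomial.tensorSub : A[X] ⊗[A] M →ₗ[A[X]] A[X] ⊗[A] M :=
  (X : A[X]) • LinearMap.id - (Algebra.lsmul A A M (X : A[X])).baseChange A[X]

variable (A M) in
/-- The action map `A[X] ⊗[A] M → M`. -/
noncomputable def Polynomial.tensorAction : A[X] ⊗[A] M →ₗ[A[X]] M :=
  LinearMap.liftBaseChange A[X] (LinearMap.id : M →ₗ[A] M)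

@[simp]
lemma Polynomial.tensorAction_tmul (p : A[X]) (m : M) : tensorAction A M (p ⊗ₜ m) = p • m := by
  simp [tensorAction]

@[simp]
lemma Polynomial.tensorSub_tmul (p : A[X]) (m : M) :
    tensorSub A M (p ⊗ₜ m) = (X * p) ⊗ₜ m - p ⊗ₜ ((X : A[X]) • m) := by
  simp [tensorSub, smul_tmul']

lemma Polynomial.tensorAction_surjective : Function.Surjective (tensorAction A M) :=
  fun m => ⟨1 ⊗ₜ m, by simp⟩

lemma Polynomial.tensorSub_injective : Function.Injective (tensorSub A M) := by
  -- The left inverse is the difference quotient `X ^ i ⊗ m ↦ ∑_{j < i} X ^ j ⊗ X ^ (i - 1 - j) m`.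
  -- On `X ^ (i + 1) ⊗ m - X ^ i ⊗ X m` everything cancels but the term `X ^ i ⊗ m`.
  let s : A[X] ⊗[A] M →ₗ[A] A[X] ⊗[A] M :=
    TensorProduct.lift (Polynomial.lsum fun i => LinearMap.toSpanSingleton A _
      (∑ j ∈ Finset.range i, TensorProduct.mk A A[X] M (X ^ j) ∘ₗ
        Algebra.lsmul A A M ((X : A[X]) ^ (i - 1 - j))))
  have hs (i : ℕ) (a : A) (m : M) : s (monomial i a ⊗ₜ m) =
      a • ∑ j ∈ Finset.range i, (X ^ j : A[X]) ⊗ₜ[A] ((X : A[X]) ^ (i - 1 - j) • m) := by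
    simp [s, Polynomial.lsum, Polynomial.sum_monomial_index, -map_pow]
  refine Function.LeftInverse.injective (g := s) fun z => ?_
  induction z using TensorProduct.induction_on with
  | zero => simp
  | add x y hx hy => simp [hx, hy]
  | tmul p m =>
    induction p using Polynomial.induction_on' with
    | add p q hp hq => simp only [add_tmul, map_add, hp, hq]
    | monomial i a =>
      rw [tensorSub_tmul, map_sub, X_mul_monomial, hs, hs]
      refine (smul_sub a _ _).symm.trans ?_
      rw [Finset.sum_range_succ, add_sub_right_comm, ← Finset.sum_sub_distrib,
        Finset.sum_eq_zero, zero_add]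
      · simp [smul_tmul', ← C_mul_X_pow_eq_monomial, smul_eq_C_mul]
      · intro j hj
        rw [Finset.mem_range] at hj
        rw [smul_smul, ← pow_succ, show i - 1 - j + 1 = i + 1 - 1 - j by omega, sub_self]

/-- Modulo the range of `tensorSub` the variable can be moved across the tensor sign, so every `z`
is congruent to `1 ⊗ tensorAction A M z`. -/
lemma Polynomial.exact_tensorSub_tensorAction :
    Function.Exact (tensorSub A M) (tensorAction A M) := by
  have h0 (z : A[X] ⊗[A] M) : tensorAction A M (tensorSub A M z) = 0 := by
    induction z using TensorProduct.induction_on with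
    | zero => simp
    | add x y hx hy => simp [hx, hy]
    | tmul p m => simp [smul_smul, mul_comm]
  have h1 (z : A[X] ⊗[A] M) :
      z - 1 ⊗ₜ tensorAction A M z ∈ LinearMap.range (tensorSub A M) := by
    induction z using TensorProduct.induction_on with
    | zero => simp
    | add x y hx hy =>
      rw [map_add, tmul_add, add_sub_add_comm]
      exact add_mem hx hy
    | tmul p m =>
      rw [tensorAction_tmul]
      induction p using Polynomial.induction_on generalizing m with
      | C a =>
        have : (C a : A[X]) ⊗ₜ[A] m = 1 ⊗ₜ (C a • m) := by
          rw [← mul_one (C a), ← smul_eq_C_mul, smul_assoc, one_smul, smul_tmul]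
        simp [this]
      | add p q hp hq =>
        rw [add_tmul, add_smul, tmul_add, add_sub_add_comm]
        exact add_mem (hp m) (hq m)
      | monomial n a h =>
        have := add_mem (h ((X : A[X]) • m)) ⟨(C a * X ^ n) ⊗ₜ m, rfl⟩
        convert this using 1
        rw [tensorSub_tmul, smul_smul, pow_succ, mul_assoc, mul_comm X (C a * X ^ n), mul_assoc]
        abel
  intro z
  refine ⟨fun hz => ?_, ?_⟩
  · simpa [hz] using h1 z
  · rintro ⟨y, rfl⟩
    exact h0 y

end PolynomialExact

/-! ### Hilbert's syzygy theorem -/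

namespace ModuleCat

open Polynomial TensorProduct

/-- Flat base change keeps short exact sequences exact and projectives projective, so it carries
syzygies to syzygies. -/
lemma hasProjectiveDimensionLE_of_flat {A S : Type u} [CommRing A] [CommRing S] [Algebra A S]
    [Module.Flat A S] (n : ℕ) (N : ModuleCat.{u} A) (hN : HasProjectiveDimensionLE N n) :
    HasProjectiveDimensionLE (ModuleCat.of S (S ⊗[A] N)) n := by
  induction n generalizing N with
  | zero =>
    have h : Projective N := (projective_iff_hasProjectiveDimensionLE_zero _).2 hN
    have : Module.Projective A N := (IsProjective.iff_projective _).2 h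
    refine (projective_iff_hasProjectiveDimensionLE_zero _).1 ?_
    exact (IsProjective.iff_projective _).1
      (inferInstanceAs (Module.Projective S (S ⊗[A] N)))
  | succ n ih =>
    have h1 := N.shortExact_projectiveShortComplex
    have h2 := ih _ ((h1.hasProjectiveDimensionLT_X₃_iff n inferInstance).1 hN)
    let f := N.projectiveShortComplex.f.hom
    let g := N.projectiveShortComplex.g.hom
    have hfg : Function.Exact f g :=
      (ShortComplex.ShortExact.moduleCat_exact_iff_function_exact _).1 h1.exact
    have hw : (g.baseChange S).comp (f.baseChange S) = 0 := by
      rw [← LinearMap.baseChange_comp, hfg.linearMap_comp_eq_zero, LinearMap.baseChange_zero]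
    have h3 : (ModuleCat.shortComplexOfCompEqZero (f.baseChange S) (g.baseChange S) hw).ShortExact :=
      ModuleCat.shortComplex_shortExact _
        (lTensor_exact S hfg h1.moduleCat_surjective_g)
        (Module.Flat.lTensor_preserves_injective_linearMap f h1.moduleCat_injective_f)
        (LinearMap.lTensor_surjective S h1.moduleCat_surjective_g)
    refine (h3.hasProjectiveDimensionLT_X₃_iff n ?_).2 h2
    have : Module.Projective S (S ⊗[A] N.projectiveShortComplex.X₂) := inferInstance
    exact (IsProjective.iff_projective _).1 this

/-- Passing to a polynomial ring raises projective dimensions by at most one. -/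
lemma hasProjectiveDimensionLE_polynomial {A : Type u} [CommRing A] (n : ℕ)
    (h : ∀ M : ModuleCat.{u} A, HasProjectiveDimensionLE M n) (M : ModuleCat.{u} A[X]) :
    HasProjectiveDimensionLE M (n + 1) := by
  let : Module A M := Module.compHom M (algebraMap A A[X])
  have : IsScalarTower A A[X] M := ⟨fun a p m => by
    rw [Algebra.smul_def, mul_smul]; rfl⟩
  have h1 : (ModuleCat.shortComplexOfCompEqZero (tensorSub A M) (tensorAction A M)
      exact_tensorSub_tensorAction.linearMap_comp_eq_zero).ShortExact :=
    ModuleCat.shortComplex_shortExact _ exact_tensorSub_tensorAction tensorSub_injective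
      tensorAction_surjective
  have h2 := hasProjectiveDimensionLE_of_flat (S := A[X]) n (ModuleCat.of A M) (h _)
  exact h1.hasProjectiveDimensionLT_X₃ (n + 1) h2
    (hasProjectiveDimensionLT_of_ge _ (n + 1) _ (by omega))

attribute [local instance] RingHomInvPair.of_ringEquiv in
lemma hasProjectiveDimensionLE_of_ringEquiv {R R' : Type u} [CommRing R] [CommRing R']
    (e : R ≃+* R') (n : ℕ) (h : ∀ M : ModuleCat.{u} R, HasProjectiveDimensionLE M n)
    (N : ModuleCat.{u} R') : HasProjectiveDimensionLE N n := by
  let : Module R N := Module.compHom N e.toRingHom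
  have := h (ModuleCat.of R N)
  let e' : ModuleCat.of R N ≃ₛₗ[RingHomClass.toRingHom e] N :=
    { AddEquiv.refl N with map_smul' := fun _ _ => rfl }
  exact hasProjectiveDimensionLE_of_semiLinearEquiv e e' n

/-- Hilbert's syzygy theorem. -/
theorem hasProjectiveDimensionLE_mvPolynomial (k : Type u) [Field k] (n : ℕ)
    (M : ModuleCat.{u} (MvPolynomial (Fin n) k)) : HasProjectiveDimensionLE M n := by
  induction n with
  | zero =>
    refine hasProjectiveDimensionLE_of_ringEquiv (MvPolynomial.isEmptyRingEquiv k (Fin 0)).symm 0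
      (fun N => ?_) M
    refine (projective_iff_hasProjectiveDimensionLE_zero _).1 ((IsProjective.iff_projective _).1 ?_)
    have : Module.Free k N := Module.Free.of_divisionRing k N
    exact Module.Projective.of_free
  | succ n ih =>
    exact hasProjectiveDimensionLE_of_ringEquiv
      (MvPolynomial.finSuccEquiv k n).symm.toRingEquiv (n + 1)
      (hasProjectiveDimensionLE_polynomial n ih) M

end ModuleCat

/-! ### Extracting `p`-th roots from polynomials -/

section FrobeniusRoot

/-- A field is a retract of its Frobenius pushforward. -/
lemma exists_frobenius_retraction (k : Type u) [Field k] (p : ℕ) [ExpChar k p] :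
    ∃ r : k →+ k, (∀ a b, r (a ^ p * b) = a * r b) ∧ r 1 = 1 := by
  -- This is `a ↦ a ^ p`, an injective map of `k`-vector spaces into `F_* k`, hence split.
  let f : k →ₗ[k] frobeniusPushforward k p := LinearMap.toSpanSingleton k _ (1 : k)
  have hf (a : k) : f a = (a ^ p * 1 : k) := rfl
  obtain ⟨g, hg⟩ := LinearMap.exists_leftInverse_of_injective f
    (LinearMap.ker_eq_bot.2 fun a b hab => by
      have h : a ^ p * 1 = b ^ p * 1 := hab
      exact frobenius_inj k p (by simpa [frobenius_def] using h))
  refine ⟨(g : frobeniusPushforward k p →+ k), fun a b => g.map_smul a (b : k), ?_⟩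
  have := LinearMap.congr_fun hg 1
  rw [LinearMap.comp_apply, hf, one_pow, one_mul] at this
  exact this

variable {σ k : Type*} [CommSemiring k]

namespace MvPolynomial

/-- Given an additive map `r`, the polynomial whose coefficient at `d` is the image under `r` of
the coefficient at `p • d + c`. -/
noncomputable def contractCoeff (r : k →+ k) (p : ℕ) (hp : p ≠ 0) (c : σ →₀ ℕ) :
    MvPolynomial σ k →+ MvPolynomial σ k where
  toFun g := AddMonoidAlgebra.ofCoeff (Finsupp.mapRange r r.map_zero
    (Finsupp.comapDomain (fun d => p • d + c) (AddMonoidAlgebra.coeff g)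
      (fun _ _ _ _ h => smul_right_injective _ hp (add_right_cancel h))))
  map_zero' := by
    ext d
    exact r.map_zero
  map_add' f g := by
    ext d
    exact r.map_add _ _

@[simp]
lemma coeff_contractCoeff (r : k →+ k) (p : ℕ) (hp : p ≠ 0) (c d : σ →₀ ℕ)
    (g : MvPolynomial σ k) : coeff d (contractCoeff r p hp c g) = r (coeff (p • d + c) g) :=
  rfl

/-- Both sides are additive in `f`, so monomials suffice. There the bound `c i < p` is what makes `p
• a ≤ p • d + c` equivalent to `a ≤ d`. -/
lemma contractCoeff_pow_mul (r : k →+ k) (p : ℕ) [ExpChar k p] (hp : p ≠ 0)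
    (hr : ∀ a b, r (a ^ p * b) = a * r b) (c : σ →₀ ℕ) (hc : ∀ i, c i < p)
    (f g : MvPolynomial σ k) :
    contractCoeff r p hp c (f ^ p * g) = f * contractCoeff r p hp c g := by
  classical
  induction f using MvPolynomial.induction_on' with
  | add f₁ f₂ h₁ h₂ => rw [add_pow_expChar, add_mul, map_add, h₁, h₂, add_mul]
  | monomial a α =>
    ext d
    rw [coeff_contractCoeff, monomial_pow, coeff_monomial_mul', coeff_monomial_mul',
      coeff_contractCoeff]
    have hiff : p • a ≤ p • d + c ↔ a ≤ d := by
      refine forall_congr' fun i => ?_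
      have := hc i
      simp only [Finsupp.smul_apply, Finsupp.add_apply, smul_eq_mul]
      constructor
      · intro h
        by_contra hlt
        nlinarith
      · intro h
        nlinarith
    by_cases had : a ≤ d
    · rw [if_pos (hiff.2 had), if_pos had, hr]
      congr 3
      ext i
      have := had i
      simp only [Finsupp.smul_apply, Finsupp.add_apply, Finsupp.tsub_apply, smul_eq_mul]
      rw [Nat.mul_sub]
      have := Nat.mul_le_mul_left p this
      omega
    · rw [if_neg (mt hiff.1 had), if_neg had, map_zero]

lemma contractCoeff_monomial (r : k →+ k) (p : ℕ) (hp : p ≠ 0) (hr : r 1 = 1) (c : σ →₀ ℕ) :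
    contractCoeff r p hp c (monomial c 1) = 1 := by
  classical
  ext d
  rw [coeff_contractCoeff, coeff_monomial, coeff_one]
  have : c = p • d + c ↔ 0 = d := by
    rw [eq_comm, add_eq_right, smul_eq_zero_iff_right hp, eq_comm]
  simp [this, apply_ite r, hr]

end MvPolynomial

end FrobeniusRoot

/-! ### The grading of the polynomial ring modulo `ℓ` -/

namespace veroneseSubalgebra

open MvPolynomial

variable {k : Type u} [CommRing k] {ℓ : ℕ}

/-- Giving each variable weight `1` in `ZMod ℓ` turns degree modulo `ℓ` into a weighted grading. -/
lemma weight_one_eq_degree {σ : Type} (d : σ →₀ ℕ) :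
    Finsupp.weight (fun _ : σ => (1 : ZMod ℓ)) d = (d.degree : ZMod ℓ) := by
  simp [Finsupp.weight_apply, Finsupp.degree_apply, Finsupp.sum]

lemma mem_iff_isWeightedHomogeneous {σ : Type} (f : MvPolynomial σ k) :
    f ∈ veroneseSubalgebra σ k ℓ ↔ IsWeightedHomogeneous (fun _ : σ => (1 : ZMod ℓ)) f 0 := by
  refine forall_congr' fun d => ?_
  rw [weight_one_eq_degree, ZMod.natCast_eq_zero_iff, mem_support_iff]

variable (k ℓ)

/-- The module over the Veronese subring spanned by the monomials whose degree is `j` modulo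
`ℓ`. -/
def part (σ : Type) (j : ZMod ℓ) : Submodule (veroneseSubalgebra σ k ℓ) (MvPolynomial σ k) where
  carrier := {f | IsWeightedHomogeneous (fun _ : σ => (1 : ZMod ℓ)) f j}
  add_mem' hf hg := hf.add hg
  zero_mem' := isWeightedHomogeneous_zero _ _ _
  smul_mem' r f hf := by
    have := ((mem_iff_isWeightedHomogeneous r.1).1 r.2).mul hf
    rwa [zero_add] at this

variable {k ℓ}

lemma mem_part {σ : Type} {j : ZMod ℓ} {f : MvPolynomial σ k} :
    f ∈ part k ℓ σ j ↔ IsWeightedHomogeneous (fun _ : σ => (1 : ZMod ℓ)) f j := Iff.rfl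

variable (k ℓ)

/-- The projection onto the part of degree `j` modulo `ℓ`. -/
noncomputable def proj (σ : Type) (j : ZMod ℓ) :
    MvPolynomial σ k →ₗ[veroneseSubalgebra σ k ℓ] part k ℓ σ j where
  toFun f := ⟨weightedHomogeneousComponent (fun _ : σ => (1 : ZMod ℓ)) j f,
    mem_part.2 (weightedHomogeneousComponent_isWeightedHomogeneous _ _)⟩
  map_add' f g := Subtype.ext (map_add _ f g)
  map_smul' r f := by
    classical
    apply Subtype.ext
    change weightedHomogeneousComponent _ j (r.1 * f) =
      r.1 * weightedHomogeneousComponent (fun _ : σ => (1 : ZMod ℓ)) j f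
    -- All monomials of `r` have weight zero, so multiplication by `r` preserves weights.
    have hr := (mem_iff_isWeightedHomogeneous r.1).1 r.2
    ext d
    rw [coeff_weightedHomogeneousComponent, coeff_mul, coeff_mul]
    split_ifs with hd
    · refine Finset.sum_congr rfl fun x hx => ?_
      by_cases h0 : coeff x.1 r.1 = 0
      · simp [h0]
      · rw [coeff_weightedHomogeneousComponent, if_pos]
        rw [← hd, ← Finset.HasAntidiagonal.mem_antidiagonal.1 hx, map_add, hr h0, zero_add]
    · refine (Finset.sum_eq_zero fun x hx => ?_).symm
      by_cases h0 : coeff x.1 r.1 = 0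
      · simp [h0]
      · rw [coeff_weightedHomogeneousComponent, if_neg, mul_zero]
        rwa [← zero_add (Finsupp.weight _ x.2), ← hr h0, ← map_add,
          Finset.HasAntidiagonal.mem_antidiagonal.1 hx]

variable {k ℓ}

lemma proj_of_mem {σ : Type} {j : ZMod ℓ} (f : part k ℓ σ j) : proj k ℓ σ j f.1 = f :=
  Subtype.ext (IsWeightedHomogeneous.weightedHomogeneousComponent_same f.2)

variable (k ℓ) in
/-- The part of degree `0` is the Veronese subring. -/
def partZeroToVeronese (σ : Type) :
    part k ℓ σ 0 →ₗ[veroneseSubalgebra σ k ℓ] veroneseSubalgebra σ k ℓ where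
  toFun f := ⟨f.1, (mem_iff_isWeightedHomogeneous f.1).2 f.2⟩
  map_add' _ _ := rfl
  map_smul' _ _ := rfl

lemma sum_proj {σ : Type} [NeZero ℓ] (f : MvPolynomial σ k) :
    ∑ j : ZMod ℓ, (proj k ℓ σ j f : MvPolynomial σ k) = f := by
  rw [← finsum_eq_sum_of_fintype]
  exact finsum_weightedHomogeneousComponent (fun _ : σ => (1 : ZMod ℓ)) f

end veroneseSubalgebra

namespace veroneseSubalgebra

open MvPolynomial

section

variable {k : Type u} [CommRing k] {ℓ : ℕ} {σ : Type} {j j' : ZMod ℓ}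

noncomputable instance : AddCommGroup (part k ℓ σ j) := Submodule.addCommGroup _

noncomputable instance : Module (veroneseSubalgebra σ k ℓ) (part k ℓ σ j) := Submodule.module _

noncomputable instance : Module (VeroneseRing k ℓ) (part k ℓ (Fin 2) j) := Submodule.module _

lemma mem_part_of_X_mul (h : j + 1 = j') (i : σ) {f : MvPolynomial σ k}
    (hf : X i * f ∈ part k ℓ σ j') : f ∈ part k ℓ σ j := by
  rw [mem_part] at hf ⊢
  intro d hd
  have := @hf (Finsupp.single i 1 + d) (by rwa [coeff_X_mul])
  rw [map_add, Finsupp.weight_single, one_smul, ← h, add_comm] at this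
  exact add_right_cancel this

/-- Multiplication by a variable, between parts. -/
noncomputable def mulX (i : σ) (h : j + 1 = j') :
    part k ℓ σ j →ₗ[veroneseSubalgebra σ k ℓ] part k ℓ σ j' :=
  (LinearMap.mulLeft (veroneseSubalgebra σ k ℓ) (X i : MvPolynomial σ k)).restrict fun f hf => by
    have := (isWeightedHomogeneous_X k (fun _ : σ => (1 : ZMod ℓ)) i).mul (mem_part.1 hf)
    rwa [add_comm, h] at this

end

/-! ### The Koszul complex in a fixed degree modulo `ℓ` -/

section

variable {k : Type u} [CommRing k] {ℓ : ℕ} {j₀ j₁ j₂ : ZMod ℓ} (h₁ : j₀ + 1 = j₁) (h₂ : j₁ + 1 = j₂)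

variable (k) in
/-- The first map of the Koszul complex of the two variables, between parts. -/
noncomputable def koszulInc : part k ℓ (Fin 2) j₀ →ₗ[VeroneseRing k ℓ] Fin 2 → part k ℓ (Fin 2) j₁ :=
  LinearMap.pi ![(mulX 1 h₁ : part k ℓ (Fin 2) j₀ →ₗ[VeroneseRing k ℓ] part k ℓ (Fin 2) j₁),
    -mulX 0 h₁]

variable (k) in
/-- The second map of the Koszul complex of the two variables, between parts. -/
noncomputable def koszulSum :
    (Fin 2 → part k ℓ (Fin 2) j₁) →ₗ[VeroneseRing k ℓ] part k ℓ (Fin 2) j₂ :=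
  mulX 0 h₂ ∘ₗ LinearMap.proj 0 + mulX 1 h₂ ∘ₗ LinearMap.proj 1

lemma koszulSum_apply (v : Fin 2 → part k ℓ (Fin 2) j₁) :
    (koszulSum k h₂ v : MvPolynomial (Fin 2) k) = X 0 * (v 0).1 + X 1 * (v 1).1 := rfl

lemma koszulInc_apply_zero (f : part k ℓ (Fin 2) j₀) :
    (koszulInc k h₁ f 0 : MvPolynomial (Fin 2) k) = X 1 * f.1 := rfl

lemma koszulInc_apply_one (f : part k ℓ (Fin 2) j₀) :
    (koszulInc k h₁ f 1 : MvPolynomial (Fin 2) k) = -(X 0 * f.1) := rfl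

/-- Dividing by `X 0`, and the remainder by `X 1`, leaves only the constant term. That has weight
zero, so `j₂ ≠ 0` excludes it. -/
lemma koszulSum_surjective (h0 : j₂ ≠ 0) : Function.Surjective (koszulSum k h₂) := by
  classical
  intro f
  let r := f.1.modMonomial (Finsupp.single 0 1)
  let g₀ := f.1.divMonomial (Finsupp.single 0 1)
  let g₁ := r.divMonomial (Finsupp.single 1 1)
  have hf := mem_part.1 f.2
  have hr : r ∈ part k ℓ (Fin 2) j₂ := by
    rw [mem_part]
    intro d hd
    by_cases hle : Finsupp.single 0 1 ≤ d
    · exact absurd (coeff_modMonomial_of_le _ hle) hd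
    · rw [coeff_modMonomial_of_not_le _ hle] at hd
      exact hf hd
  have hdiv (q : MvPolynomial (Fin 2) k) (hq : q ∈ part k ℓ (Fin 2) j₂) (i : Fin 2) :
      q.divMonomial (Finsupp.single i 1) ∈ part k ℓ (Fin 2) j₁ := by
    rw [mem_part] at hq ⊢
    intro d hd
    rw [coeff_divMonomial] at hd
    have := hq hd
    rw [map_add, Finsupp.weight_single, one_smul, ← h₂, add_comm] at this
    exact add_right_cancel this
  refine ⟨![⟨g₀, hdiv _ f.2 0⟩, ⟨g₁, hdiv _ hr 1⟩], Subtype.ext ?_⟩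
  rw [koszulSum_apply]
  change X 0 * g₀ + X 1 * g₁ = f.1
  have hrest : r.modMonomial (Finsupp.single 1 1) = 0 := by
    ext d
    rw [coeff_zero]
    by_contra hd
    by_cases hle : Finsupp.single 1 1 ≤ d
    · exact hd (coeff_modMonomial_of_le _ hle)
    rw [coeff_modMonomial_of_not_le _ hle] at hd
    by_cases hle' : Finsupp.single 0 1 ≤ d
    · exact hd (coeff_modMonomial_of_le _ hle')
    have hd0 : d = 0 := by
      ext i
      rw [Finsupp.single_le_iff] at hle hle'
      fin_cases i <;> simp_all
    apply h0
    rw [← mem_part.1 hr hd, hd0, map_zero]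
  have e₁ : X 1 * g₁ = r := by
    have := divMonomial_add_modMonomial_single r 1
    rwa [hrest, add_zero] at this
  rw [e₁]
  exact divMonomial_add_modMonomial_single f.1 0

lemma koszulInc_injective [IsDomain k] : Function.Injective (koszulInc k h₁) := by
  intro f g hfg
  have := congrArg (fun v : Fin 2 → part k ℓ (Fin 2) j₁ => (v 0 : MvPolynomial (Fin 2) k)) hfg
  simp only [koszulInc_apply_zero] at this
  exact Subtype.ext (mul_left_cancel₀ (X_ne_zero 1) this)

/-- If `X 0 * v 0 + X 1 * v 1 = 0`, then `X 1` divides `X 0 * v 0` and hence `v 0`; the quotient is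
the preimage. -/
lemma koszul_exact [IsDomain k] : Function.Exact (koszulInc k h₁) (koszulSum k h₂) := by
  intro v
  constructor
  · intro hv
    have hv' := congrArg Subtype.val hv
    rw [koszulSum_apply] at hv'
    change _ = (0 : MvPolynomial (Fin 2) k) at hv'
    have hdvd : (X 1 : MvPolynomial (Fin 2) k) ∣ X 0 * (v 0).1 :=
      ⟨-(v 1).1, by linear_combination hv'⟩
    rcases X_dvd_mul_iff.1 hdvd with h | ⟨q, hq⟩
    · simp at h
    · have hq' : q ∈ part k ℓ (Fin 2) j₀ := mem_part_of_X_mul h₁ 1 (hq ▸ (v 0).2)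
      refine ⟨⟨q, hq'⟩, funext fun i => Subtype.ext ?_⟩
      fin_cases i
      · exact hq.symm
      · change -(X 0 * q) = (v 1).1
        apply mul_left_cancel₀ (X_ne_zero (R := k) (1 : Fin 2))
        rw [hq] at hv'
        linear_combination -hv'
  · rintro ⟨f, rfl⟩
    apply Subtype.ext
    rw [koszulSum_apply, koszulInc_apply_zero, koszulInc_apply_one]
    change _ = (0 : MvPolynomial (Fin 2) k)
    ring

end

/-! ### Finiteness over the Veronese ring -/

section Finiteness

variable (k : Type u) [Field k] {ℓ : ℕ} (hℓ : ℓ ≠ 0)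
include hℓ

lemma finite_mvPolynomial : Module.Finite (VeroneseRing k ℓ) (MvPolynomial (Fin 2) k) := by
  have hX (i : Fin 2) : (X i ^ ℓ : MvPolynomial (Fin 2) k) ∈ veroneseSubalgebra (Fin 2) k ℓ := by
    have := (isWeightedHomogeneous_X k (fun _ : Fin 2 => (1 : ZMod ℓ)) i).pow ℓ
    rw [nsmul_one, ZMod.natCast_self] at this
    exact (mem_iff_isWeightedHomogeneous _).2 this
  have hint : Algebra.IsIntegral (VeroneseRing k ℓ) (MvPolynomial (Fin 2) k) := by
    refine ⟨fun f => ?_⟩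
    induction f using MvPolynomial.induction_on with
    | C a => exact isIntegral_algebraMap (x := algebraMap k (VeroneseRing k ℓ) a)
    | add f g hf hg => exact hf.add hg
    | mul_X f i hf =>
      refine hf.mul (IsIntegral.of_pow (Nat.pos_of_ne_zero hℓ) ?_)
      exact isIntegral_algebraMap (x := (⟨_, hX i⟩ : VeroneseRing k ℓ))
  have : Algebra.FiniteType (VeroneseRing k ℓ) (MvPolynomial (Fin 2) k) :=
    Algebra.FiniteType.of_restrictScalars_finiteType k _ _
  exact Algebra.IsIntegral.finite

/-- This is the Artin–Tate lemma for `k ⊆ R ⊆ S`. -/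
lemma finiteType : Algebra.FiniteType k (VeroneseRing k ℓ) :=
  ⟨fg_of_fg_of_fg k (VeroneseRing k ℓ) (MvPolynomial (Fin 2) k)
    (inferInstance : Algebra.FiniteType k (MvPolynomial (Fin 2) k)).out
    (finite_mvPolynomial k hℓ).fg_top Subtype.val_injective⟩

omit hℓ in
lemma _root_.frobenius_isIntegral (R : Type*) [CommRing R] (p : ℕ) [ExpChar R p] :
    (frobenius R p).IsIntegral := by
  intro x
  refine ⟨Polynomial.X ^ p - Polynomial.C x, Polynomial.monic_X_pow_sub_C x
    (expChar_pos R p).ne', ?_⟩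
  simp [frobenius_def]

/-- Frobenius is integral, so finite type suffices. Precomposed with `k → R` it equals Frobenius of
`k` followed by `k → R`, which is of finite type by `F`-finiteness. -/
lemma isFG_frobeniusPushforward (p : ℕ) [Fact p.Prime] [CharP k p] (hk : (frobenius k p).Finite) :
    ModuleCat.isFG (VeroneseRing k ℓ) (frobeniusPushforward (VeroneseRing k ℓ) p) := by
  have h1 : (algebraMap k (VeroneseRing k ℓ)).FiniteType := by
    rw [RingHom.finiteType_algebraMap]
    exact finiteType k hℓ
  have h2 : ((frobenius (VeroneseRing k ℓ) p).comp (algebraMap k (VeroneseRing k ℓ))).FiniteType := by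
    have : (frobenius (VeroneseRing k ℓ) p).comp (algebraMap k (VeroneseRing k ℓ)) =
        (algebraMap k (VeroneseRing k ℓ)).comp (frobenius k p) := by
      ext a
      simp [frobenius_def]
    rw [this]
    exact h1.comp hk.finiteType
  exact (frobenius_isIntegral (VeroneseRing k ℓ) p).to_finite h2.of_comp_finiteType

end Finiteness

/-! ### Parts of the polynomial ring as summands of `F_* R` -/

section Frobenius

variable {k : Type u} [Field k] {ℓ p : ℕ} [Fact p.Prime] [CharP k p]

/-- A monomial `X ^ c` with exponents less than `p` whose degree is `-p j` modulo `ℓ` makes the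
part of degree `j` a retract of the Frobenius pushforward of the Veronese ring. -/
lemma exists_retraction_frobeniusPushforward (j : ZMod ℓ) (c : Fin 2 →₀ ℕ) (hc : ∀ i, c i < p)
    (hj : p • j + (c.degree : ZMod ℓ) = 0) :
    ∃ (i : part k ℓ (Fin 2) j →ₗ[VeroneseRing k ℓ] frobeniusPushforward (VeroneseRing k ℓ) p)
      (r : frobeniusPushforward (VeroneseRing k ℓ) p →ₗ[VeroneseRing k ℓ] part k ℓ (Fin 2) j),
      r ∘ₗ i = LinearMap.id := by
  obtain ⟨ρ, hρ, hρ1⟩ := exists_frobenius_retraction k p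
  have hp : p ≠ 0 := (Fact.out : p.Prime).ne_zero
  let i : part k ℓ (Fin 2) j →ₗ[VeroneseRing k ℓ] frobeniusPushforward (VeroneseRing k ℓ) p :=
    { toFun f := (⟨f.1 ^ p * monomial c 1, by
        rw [mem_iff_isWeightedHomogeneous, ← hj]
        exact ((mem_part.1 f.2).pow p).mul
          (isWeightedHomogeneous_monomial _ _ _ (weight_one_eq_degree c))⟩ : VeroneseRing k ℓ)
      map_add' := fun f g => Subtype.ext (by
        change (f.1 + g.1) ^ p * _ = f.1 ^ p * _ + g.1 ^ p * _
        rw [add_pow_expChar, add_mul])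
      map_smul' := fun a f => Subtype.ext (by
        change (a.1 * f.1) ^ p * _ = a.1 ^ p * (f.1 ^ p * _)
        rw [mul_pow, mul_assoc]) }
  -- The projection is needed when `p` divides `ℓ`: then `p • d + c` having weight zero does not
  -- force `d` to have weight `j`.
  let r : frobeniusPushforward (VeroneseRing k ℓ) p →ₗ[VeroneseRing k ℓ] part k ℓ (Fin 2) j :=
    { toFun g := proj k ℓ (Fin 2) j (contractCoeff ρ p hp c (show VeroneseRing k ℓ from g).1)
      map_add' := fun f g => by
        rw [← map_add, ← map_add]
        rfl
      map_smul' := fun a g => by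
        refine Eq.trans ?_ ((proj k ℓ (Fin 2) j).map_smul a _)
        exact congrArg (proj k ℓ (Fin 2) j) (contractCoeff_pow_mul ρ p hp hρ c hc a.1
          (show VeroneseRing k ℓ from g).1) }
  refine ⟨i, r, LinearMap.ext fun f => ?_⟩
  change proj k ℓ (Fin 2) j (contractCoeff ρ p hp c (f.1 ^ p * monomial c 1)) = f
  rw [contractCoeff_pow_mul ρ p hp hρ c hc, contractCoeff_monomial ρ p hp hρ1, mul_one, proj_of_mem]

end Frobenius

end veroneseSubalgebra

/-! ### Building the polynomial ring from `F_* R` -/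

namespace DerivedCategory

open veroneseSubalgebra

variable {k : Type u} [Field k] {ℓ : ℕ}

section

variable {R : Type u} [CommRing R] [IsNoetherianRing R]
  [HasDerivedCategory.{w} (FGModuleCat.{u} R)]
  {P : ObjectProperty (Bounded (FGModuleCat.{u} R))} {n : ℕ}

lemma heartLevel_of_linearRetract {M N : Type u} [AddCommGroup M] [Module R M] [Module.Finite R M]
    [AddCommGroup N] [Module R N] [Module.Finite R N] (i : M →ₗ[R] N) (r : N →ₗ[R] M)
    (h : r ∘ₗ i = LinearMap.id) (hN : heartLevel P n (.of R N)) : heartLevel P n (.of R M) :=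
  (heartLevel P n).prop_of_retract
    ⟨FGModuleCat.ofHom i, FGModuleCat.ofHom r, FGModuleCat.hom_ext h⟩ hN

lemma heartLevel_of_sum_eq_id_linear (hP : P.Nonempty) {ι : Type*} [Fintype ι] {M : Type u}
    [AddCommGroup M] [Module R M] [Module.Finite R M] (N : ι → Type u) [∀ j, AddCommGroup (N j)]
    [∀ j, Module R (N j)] [∀ j, Module.Finite R (N j)] (a : ∀ j, M →ₗ[R] N j)
    (b : ∀ j, N j →ₗ[R] M) (h : ∀ x, ∑ j, b j (a j x) = x)
    (hN : ∀ j, heartLevel P n (.of R (N j))) : heartLevel P n (.of R M) := by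
  refine heartLevel_of_sum_eq_id hP Finset.univ (fun j => .of R (N j)) hN
    (fun j => FGModuleCat.ofHom (a j)) (fun j => FGModuleCat.ofHom (b j)) ?_
  apply FGModuleCat.hom_ext
  ext x
  have h1 : (∑ j, FGModuleCat.ofHom (a j) ≫ FGModuleCat.ofHom (b j)).hom.hom =
      ∑ j, (FGModuleCat.ofHom (a j) ≫ FGModuleCat.ofHom (b j)).hom.hom :=
    map_sum (⟨⟨fun f : (FGModuleCat.of R M) ⟶ FGModuleCat.of R M => f.hom.hom, rfl⟩,
      fun _ _ => rfl⟩ : ((FGModuleCat.of R M) ⟶ FGModuleCat.of R M) →+ (M →ₗ[R] M)) _ _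
  rw [h1, LinearMap.sum_apply]
  exact h x

lemma heartLevel_of_linearExact₃ {m : ℕ} {M N L : Type u} [AddCommGroup M] [Module R M]
    [Module.Finite R M] [AddCommGroup N] [Module R N] [Module.Finite R N] [AddCommGroup L]
    [Module R L] [Module.Finite R L] (f : M →ₗ[R] N) (g : N →ₗ[R] L) (hf : Function.Injective f)
    (hfg : Function.Exact f g) (hg : Function.Surjective g) (hM : heartLevel P n (.of R M))
    (hN : heartLevel P m (.of R N)) : heartLevel P (m + n + 1) (.of R L) :=
  heartLevel_of_shortExact₃ (FGModuleCat.shortExact_of_exact (FGModuleCat.ofHom f)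
    (FGModuleCat.ofHom g) (FGModuleCat.hom_ext hfg.linearMap_comp_eq_zero) hf hfg hg) hM hN

lemma heartLevel_of_linearExact_pi (hP : P.Nonempty) {ι : Type} [Fintype ι] [DecidableEq ι]
    {m : ℕ} {M N L : Type u} [AddCommGroup M] [Module R M]
    [Module.Finite R M] [AddCommGroup N] [Module R N] [Module.Finite R N] [AddCommGroup L]
    [Module R L] [Module.Finite R L] (f : M →ₗ[R] ι → N) (g : (ι → N) →ₗ[R] L)
    (hf : Function.Injective f) (hfg : Function.Exact f g) (hg : Function.Surjective g)
    (hM : heartLevel P n (.of R M)) (hN : heartLevel P m (.of R N)) :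
    heartLevel P (m + n + 1) (.of R L) :=
  heartLevel_of_linearExact₃ f g hf hfg hg hM
    (heartLevel_of_sum_eq_id_linear hP (fun _ : ι => N) (fun j => LinearMap.proj j)
      (fun j => LinearMap.single R (fun _ : ι => N) j) (fun x => Finset.univ_sum_single x) fun _ => hN)

end

section

variable [HasDerivedCategory.{w} (FGModuleCat.{u} (VeroneseRing k ℓ))]
  {P : ObjectProperty (Bounded (FGModuleCat.{u} (VeroneseRing k ℓ)))}
  [∀ j, Module.Finite (VeroneseRing k ℓ) (part k ℓ (Fin 2) j)]

/-- If the parts of degree `-1` and `0` of the polynomial ring are built from `P`, then so are all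
other parts. -/
lemma exists_heartLevel_part (hP : P.Nonempty)
    (h : ∃ n, heartLevel P n (.of _ (part k ℓ (Fin 2) (-1))))
    (h' : ∃ n, heartLevel P n (.of _ (part k ℓ (Fin 2) 0))) (i : ℕ) (hi : i < ℓ) :
    (∃ n, heartLevel P n (.of _ (part k ℓ (Fin 2) ((i : ZMod ℓ) - 1)))) ∧
      ∃ n, heartLevel P n (.of _ (part k ℓ (Fin 2) (i : ZMod ℓ))) := by
  induction i with
  | zero =>
    rw [Nat.cast_zero, zero_sub]
    exact ⟨h, h'⟩
  | succ i ih =>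
    obtain ⟨⟨n, hn⟩, m, hm⟩ := ih (by omega)
    -- As `i + 1 < ℓ`, the target part is not the one of degree zero, where `koszulSum` misses the
    -- constants.
    have h2 : ((i : ZMod ℓ) + 1) ≠ 0 := by
      have : ((i + 1 : ℕ) : ZMod ℓ) ≠ 0 := by
        rw [Ne, ZMod.natCast_eq_zero_iff]
        exact Nat.not_dvd_of_pos_of_lt (by omega) hi
      exact_mod_cast this
    rw [Nat.cast_add, Nat.cast_one, add_sub_cancel_right]
    refine ⟨⟨m, hm⟩, m + n + 1, ?_⟩
    exact heartLevel_of_linearExact_pi hP (koszulInc k (sub_add_cancel (i : ZMod ℓ) 1))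
      (koszulSum k rfl) (koszulInc_injective _) (koszul_exact _ _) (koszulSum_surjective _ h2)
      hn hm

lemma exists_heartLevel_mvPolynomial [NeZero ℓ]
    [Module.Finite (VeroneseRing k ℓ) (MvPolynomial (Fin 2) k)] (hP : P.Nonempty)
    (h : ∃ n, heartLevel P n (.of _ (part k ℓ (Fin 2) (-1))))
    (h' : ∃ n, heartLevel P n (.of _ (part k ℓ (Fin 2) 0))) :
    ∃ n, heartLevel P n (.of (VeroneseRing k ℓ) (MvPolynomial (Fin 2) k)) := by
  have hall (j : ZMod ℓ) : ∃ n, heartLevel P n (.of _ (part k ℓ (Fin 2) j)) := by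
    have := (exists_heartLevel_part hP h h' j.val (ZMod.val_lt j)).2
    rwa [ZMod.natCast_zmod_val] at this
  choose n hn using hall
  -- Direct sums cost no extension, so the maximum of the levels is enough.
  exact ⟨Finset.univ.sup n, heartLevel_of_sum_eq_id_linear hP (fun j => part k ℓ (Fin 2) j)
    (fun j => proj k ℓ (Fin 2) j) (fun j => (part k ℓ (Fin 2) j).subtype) sum_proj
    fun j => heartLevel_mono (Finset.le_sup (Finset.mem_univ j)) (hn j)⟩

end

variable [HasDerivedCategory.{w} (FGModuleCat.{u} (VeroneseRing k ℓ))]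

/-- If the Frobenius pushforward of the Veronese ring is finitely generated, it is a strong
generator. -/
theorem isStrongTriangulatedGenerator_frobeniusPushforward (p : ℕ) [Fact p.Prime] [CharP k p]
    (hℓ0 : ℓ ≠ 0)
    (hfg : ModuleCat.isFG (VeroneseRing k ℓ) (frobeniusPushforward (VeroneseRing k ℓ) p)) :
    (ObjectProperty.singleton
      (boundedDerivedSingle
        (⟨frobeniusPushforward (VeroneseRing k ℓ) p, hfg⟩ :
          FGModuleCat.{u} (VeroneseRing k ℓ)))).IsStrongTriangulatedGenerator := by
  have : NeZero ℓ := ⟨hℓ0⟩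
  have hp : p.Prime := Fact.out
  let P := ObjectProperty.singleton
    (boundedDerivedSingle
      (⟨frobeniusPushforward (VeroneseRing k ℓ) p, hfg⟩ : FGModuleCat.{u} (VeroneseRing k ℓ)))
  have hP : P.Nonempty := inferInstance
  have hF : Module.Finite (VeroneseRing k ℓ) (frobeniusPushforward (VeroneseRing k ℓ) p) := hfg
  have : Module.Finite (VeroneseRing k ℓ) (MvPolynomial (Fin 2) k) := finite_mvPolynomial k hℓ0
  have hfin (j) : Module.Finite (VeroneseRing k ℓ) (part k ℓ (Fin 2) j) :=
    Module.Finite.of_fg (IsNoetherian.noetherian (part k ℓ (Fin 2) j))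
  have hR : heartLevel P 0
      (FGModuleCat.of (VeroneseRing k ℓ) (frobeniusPushforward (VeroneseRing k ℓ) p)) :=
    P.le_triangEnvelopeIter 0 _ ((ObjectProperty.singleton_iff _ _).2 rfl)
  have hpart (j : ZMod ℓ) (c : Fin 2 →₀ ℕ) (hc : ∀ i, c i < p)
      (hj : p • j + (c.degree : ZMod ℓ) = 0) :
      ∃ n, heartLevel P n (.of (VeroneseRing k ℓ) (part k ℓ (Fin 2) j)) := by
    obtain ⟨i, r, hir⟩ := exists_retraction_frobeniusPushforward (k := k) j c hc hj
    exact ⟨0, heartLevel_of_linearRetract i r hir hR⟩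
  have h0 := hpart 0 0 (fun _ => hp.pos) (by simp)
  -- The monomial `x * y ^ (p - 1)` has degree `p = -p * (-1)`, and both exponents are less than
  -- `p`.
  have h1 := hpart (-1) (Finsupp.single 0 1 + Finsupp.single 1 (p - 1))
    (fun i => by
      have := hp.two_le
      fin_cases i
      · simpa using hp.one_lt
      · simpa using hp.pos)
    (by
      have : 1 + (p - 1) = p := by have := hp.pos; omega
      rw [map_add, Finsupp.degree_single, Finsupp.degree_single, this]
      simp)
  obtain ⟨n, hn⟩ := exists_heartLevel_mvPolynomial hP h1 h0
  -- The splitting of `R ⊆ S` is the projection to degree zero; the bound `2` is the number of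
  -- variables.
  refine isStrongTriangulatedGenerator_of_split (S := MvPolynomial (Fin 2) k) hP
    (partZeroToVeronese k ℓ (Fin 2) ∘ₗ proj k ℓ (Fin 2) 0) ?_ 2
    (fun M => ModuleCat.hasProjectiveDimensionLE_mvPolynomial k 2 M.obj) (n := n) hn
  exact congrArg (partZeroToVeronese k ℓ (Fin 2))
    (proj_of_mem (⟨1, mem_part.2 (MvPolynomial.isWeightedHomogeneous_one _ _)⟩ :
      part k ℓ (Fin 2) 0))

end DerivedCategory

/-- `HasDerivedCategory` is Mathlib's choice of a model of the localization at quasi-isomorphisms;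
such a model always exists. The pushforward `F_* R` is an object of the bounded derived category
because it is finitely generated, which is part of the claim. -/
theorem mainTheorem11 (p : ℕ) [Fact p.Prime] (k : Type u) [Field k] [CharP k p]
    (hk : (frobenius k p).Finite) (ℓ : ℕ) (hℓ : 1 ≤ ℓ)
    [HasDerivedCategory.{w} (FGModuleCat.{u} (VeroneseRing k ℓ))] :
    ∃ hfg : ModuleCat.isFG (VeroneseRing k ℓ) (frobeniusPushforward (VeroneseRing k ℓ) p),
      (ObjectProperty.singleton
        (boundedDerivedSingle
          (⟨frobeniusPushforward (VeroneseRing k ℓ) p, hfg⟩ :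
            FGModuleCat.{u} (VeroneseRing k ℓ)))).IsStrongTriangulatedGenerator := by
  have hℓ0 : ℓ ≠ 0 := Nat.one_le_iff_ne_zero.1 hℓ
  have hfg := veroneseSubalgebra.isFG_frobeniusPushforward k hℓ0 p hk
  exact ⟨hfg, DerivedCategory.isStrongTriangulatedGenerator_frobeniusPushforward p hℓ0 hfg⟩
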